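/- Let $E$ be a Dedekind complete Riesz space with weak order unit $e\ge 0$, and let $\mathbb F$ be a conditional expectation on $E$, i.e. a strictly positive, order continuous linear projection $\mathbb F:E\to E$ with $\mathbb F e=e$ and Dedekind complete range (so $(E,e,\mathbb F)$ is a conditional Riesz triple). Let $E^u$ be the universal completion of $E$, that is, a Dedekind complete and laterally complete Riesz space containing $E$ as an order dense Riesz subspace, equipped with its $f$-algebra structure with unit $e$. The operator $\mathbb F$ is extended to its natural domain $L^1(\mathbb F)\subseteq E^u$: for $0\le x\in E^u$ put $\mathbb F x=\sup\{\mathbb F z: z\in E,\ 0\le z\le x\}$ if this supremum exists in $E^u$; let $L^1(\mathbb F)$ be the set of all $x\in E^u$ for which $\mathbb F x^+$ and $\mathbb F x^-$ both exist, and put $\mathbb F x=\mathbb F x^+-\mathbb F x^-$ for such $x$. Let $R(\mathbb F)=\mathbb F(L^1(\mathbb F))$ be the range of the extended operator, $R(\mathbb F)^+=\{h\in R(\mathbb F): h\ge 0\}$, and $$L^\infty(\mathbb F)=\{x\in L^1(\mathbb F): |x|\le u \text{ for some } u\in R(\mathbb F)\}.$$ For $f\in L^\infty(\mathbb F)$ the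 conditional supremum of $f$ is $$M_{\mathbb F}(f)=\inf\{g\in R(\mathbb F): f\le g\},$$ the infimum being taken in $E^u$. Let $f\in L^\infty(\mathbb F)$ and $h\in R(\mathbb F)^+$. Then the infimum $M_{\mathbb F}(f)$ exists and lies in $R(\mathbb F)$; the product $hf$ lies in $L^\infty(\mathbb F)$, so that likewise $M_{\mathbb F}(hf)$ exists and lies in $R(\mathbb F)$; and $$M_{\mathbb F}(hf)=h\,M_{\mathbb F}(f).$$ -/

import Mathlib

namespace RieszCond

section Order

/-- Every non-empty subset that is bounded above has a supremum. -/
def DedekindComplete (E : Type*) [PartialOrder E] : Prop :=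
  ∀ s : Set E, s.Nonempty → BddAbove s → ∃ a, IsLUB s a

end Order

section RieszSpace

/-! A Riesz space is a real vector space `E` with a lattice order such that addition and
multiplication by non-negative scalars are monotone, that is,
`[AddCommGroup E] [Lattice E] [IsOrderedAddMonoid E] [Module ℝ E] [PosSMulMono ℝ E]`. -/

variable {E : Type*} [AddCommGroup E] [Lattice E] [Module ℝ E]

/-- A band: a linear subspace that is solid (an ideal) and closed under arbitrary suprema. -/
structure IsBand (B : Submodule ℝ E) : Prop where
  solid : ∀ f ∈ B, ∀ g : E, |g| ≤ |f| → g ∈ B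
  isLUB_mem : ∀ (s : Set E) (a : E), s ⊆ (B : Set E) → IsLUB s a → a ∈ B

/-- A weak order unit: a positive element `e` such that the band generated by `e` is all of `E`,
that is, `E` is the only band containing `e`. -/
structure IsWeakOrderUnit (e : E) : Prop where
  nonneg : 0 ≤ e
  band_eq_top : ∀ B : Submodule ℝ E, IsBand B → e ∈ B → B = ⊤

/-- Every non-empty set of mutually disjoint elements has a supremum. -/
def LaterallyComplete (E : Type*) [AddCommGroup E] [Lattice E] : Prop :=
  ∀ s : Set E, s.Nonempty → s.Pairwise (fun a b => |a| ⊓ |b| = 0) → ∃ a, IsLUB s a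

/-- A conditional expectation operator on the Riesz space `E` with respect to `e`: a strictly
positive order continuous linear projection with Dedekind complete range that fixes `e`.
Order continuity of a positive operator is expressed by means of downward directed sets with
infimum `0`. -/
structure IsConditionalExpectation (e : E) (F : E →ₗ[ℝ] E) : Prop where
  idem : ∀ x, F (F x) = F x
  strictlyPositive : ∀ x, 0 < x → 0 < F x
  orderContinuous : ∀ D : Set E, D.Nonempty → DirectedOn (fun x y => y ≤ x) D →
    IsGLB D 0 → IsGLB (F '' D) 0
  map_unit : F e = e
  range_complete : DedekindComplete (LinearMap.range F)

/-- `(E, e, F)` is a conditional Riesz triple. -/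
structure IsConditionalRieszTriple (e : E) (F : E →ₗ[ℝ] E) : Prop where
  complete : DedekindComplete E
  unit : IsWeakOrderUnit e
  condExp : IsConditionalExpectation e F

end RieszSpace

section UniversalCompletion

variable {E U : Type*} [AddCommGroup E] [Lattice E] [Module ℝ E]
  [AddCommGroup U] [Lattice U] [Module ℝ U]

/-- `ι : E → U` exhibits `U` as the universal completion of `E`: `U` is universally complete
(Dedekind complete and laterally complete), and `ι` is an isomorphism of `E` onto an
order dense Riesz subspace of `U`. -/
structure IsUniversalCompletion (ι : E →ₗ[ℝ] U) : Prop where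
  injective : Function.Injective ι
  map_sup : ∀ x y, ι (x ⊔ y) = ι x ⊔ ι y
  dedekindComplete : DedekindComplete U
  laterallyComplete : LaterallyComplete U
  orderDense : ∀ u : U, 0 < u → ∃ x : E, 0 < ι x ∧ ι x ≤ u

/-- `y` is the value at `x ≥ 0` of the extension of `F` to the positive cone of its natural
domain: `y = sup {F z : z ∈ E, 0 ≤ z ≤ x}`, the supremum being taken in `U`. -/
def ExtendsPos (ι : E →ₗ[ℝ] U) (F : E →ₗ[ℝ] E) (x y : U) : Prop :=
  IsLUB {w : U | ∃ z : E, 0 ≤ z ∧ ι z ≤ x ∧ w = ι (F z)} y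

/-- The graph of the extension of `F` to its natural domain: `F x = F x⁺ - F x⁻`, where both
terms have to exist in `U`. -/
def Extends (ι : E →ₗ[ℝ] U) (F : E →ₗ[ℝ] E) (x y : U) : Prop :=
  ∃ y₁ y₂ : U, ExtendsPos ι F x⁺ y₁ ∧ ExtendsPos ι F x⁻ y₂ ∧ y = y₁ - y₂

/-- The natural domain `L¹(F)` of `F` in the universal completion. -/
def L1 (ι : E →ₗ[ℝ] U) (F : E →ₗ[ℝ] E) : Set U := {x | ∃ y, Extends ι F x y}

/-- The range `R(F)` of the extension of `F` to its natural domain. -/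
def R (ι : E →ₗ[ℝ] U) (F : E →ₗ[ℝ] E) : Set U := {y | ∃ x, Extends ι F x y}

/-- The space `L^∞(F)`. -/
def LInfty (ι : E →ₗ[ℝ] U) (F : E →ₗ[ℝ] E) : Set U :=
  {x | x ∈ L1 ι F ∧ ∃ u ∈ R ι F, |x| ≤ u}

open Classical in
/-- The conditional supremum `M_F(f) = inf {g ∈ R(F) : f ≤ g}`, the infimum being taken in `U`
(with value `0` if there is no infimum). -/
noncomputable def condSup (ι : E →ₗ[ℝ] U) (F : E →ₗ[ℝ] E) (f : U) : U :=
  if h : ∃ m, IsGLB {g | g ∈ R ι F ∧ f ≤ g} m then h.choose else 0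

end UniversalCompletion

section FAlgebra

/-- The axioms linking product and order in an `f`-algebra. -/
structure IsFAlgebra (A : Type*) [Ring A] [Lattice A] : Prop where
  mul_nonneg : ∀ a b : A, 0 ≤ a → 0 ≤ b → 0 ≤ a * b
  disjoint_mul : ∀ a b c : A, 0 ≤ a → 0 ≤ b → 0 ≤ c → a ⊓ b = 0 →
    (a * c) ⊓ (b * c) = 0 ∧ (c * a) ⊓ (c * b) = 0

end FAlgebra

end RieszCond

set_option linter.unusedSectionVars false

/-! The key fact is `mem_R_iff`: `R(F)` is the closure of `ι (range F)` under all existing suprema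
and infima of non-empty sets. This makes `R(F)` a Riesz subspace containing `M_F(f)`. It is closed
under products with positive `h`, because `orderClosure_mul` builds `h * x` from linear and lattice
operations and suprema alone.

For the averaging identity (`isGLB_mul`) put `m = M_F(f)`. Then `h * m` is in `R(F)` and dominates
`h * f`. If `g ∈ R(F)` also dominates `h * f`, cut the excess `(h * m - g)⁺` down by `(n - h)⁺`. The
result `z` lies in `R(F)` and `z ≤ n * (m - f)`, so `m - z / n` is still an upper bound of `f` in
`R(F)`. Minimality of `m` forces `z ≤ 0` for every `n`, hence `h * m ≤ g`. No inverse of `h` is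
needed. -/

namespace RieszCond

/-! ### Lattice-ordered groups: distributivity and the Archimedean property. -/

section LatticeGroup

variable {G : Type*} [AddCommGroup G] [Lattice G] [IsOrderedAddMonoid G]

lemma isLUB_inf_const {s : Set G} {a : G} (h : IsLUB s a) (b : G) :
    IsLUB ((fun x => x ⊓ b) '' s) (a ⊓ b) := by
  constructor
  · rintro _ ⟨x, hx, rfl⟩
    exact inf_le_inf_right b (h.1 hx)
  · intro v hv
    have key : a ≤ v - b + a ⊔ b := h.2 fun x hx => by
      have h1 : x ⊓ b ≤ v := hv ⟨x, hx, rfl⟩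
      have h2 : x ⊓ b + x ⊔ b = x + b := inf_add_sup x b
      have h3 : x ⊔ b ≤ a ⊔ b := sup_le_sup_right (h.1 hx) b
      calc x = x ⊓ b - b + x ⊔ b := by rw [sub_add_eq_add_sub, h2]; abel
        _ ≤ v - b + a ⊔ b := by gcongr
    have h2 : a ⊓ b + a ⊔ b = a + b := inf_add_sup a b
    calc a ⊓ b = a + b - a ⊔ b := by rw [← h2]; abel
      _ ≤ (v - b + a ⊔ b) + b - a ⊔ b := by gcongr
      _ = v := by abel

lemma isGLB_sup_const {s : Set G} {a : G} (h : IsGLB s a) (b : G) :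
    IsGLB ((fun x => x ⊔ b) '' s) (a ⊔ b) := by
  constructor
  · rintro _ ⟨x, hx, rfl⟩
    exact sup_le_sup_right (h.1 hx) b
  · intro v hv
    have key : v - b + a ⊓ b ≤ a := h.2 fun x hx => by
      have h1 : v ≤ x ⊔ b := hv ⟨x, hx, rfl⟩
      have h2 : x ⊓ b + x ⊔ b = x + b := inf_add_sup x b
      have h3 : a ⊓ b ≤ x ⊓ b := inf_le_inf_right b (h.1 hx)
      calc v - b + a ⊓ b ≤ x ⊔ b - b + x ⊓ b := by gcongr
        _ = x := by rw [sub_add_eq_add_sub, add_comm (x ⊔ b), h2]; abel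
    have h2 : a ⊓ b + a ⊔ b = a + b := inf_add_sup a b
    calc v = (v - b + a ⊓ b) + b - a ⊓ b := by abel
      _ ≤ a + b - a ⊓ b := by gcongr
      _ = a ⊔ b := by rw [← h2]; abel

lemma isLUB_sup_const {G : Type*} [Lattice G] {s : Set G} (hs : s.Nonempty) {a : G} (h : IsLUB s a) (b : G) :
    IsLUB ((fun x => x ⊔ b) '' s) (a ⊔ b) := by
  constructor
  · rintro _ ⟨x, hx, rfl⟩
    exact sup_le_sup_right (h.1 hx) b
  · intro v hv
    obtain ⟨y, hy⟩ := hs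
    exact sup_le (h.2 fun x hx => le_sup_left.trans (hv ⟨x, hx, rfl⟩))
      (le_sup_right.trans (hv ⟨y, hy, rfl⟩))

lemma isGLB_inf_const {G : Type*} [Lattice G] {s : Set G} (hs : s.Nonempty) {a : G} (h : IsGLB s a) (b : G) :
    IsGLB ((fun x => x ⊓ b) '' s) (a ⊓ b) := by
  constructor
  · rintro _ ⟨x, hx, rfl⟩
    exact inf_le_inf_right b (h.1 hx)
  · intro v hv
    obtain ⟨y, hy⟩ := hs
    exact le_inf (h.2 fun x hx => (hv ⟨x, hx, rfl⟩).trans inf_le_left)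
      ((hv ⟨y, hy, rfl⟩).trans inf_le_right)

lemma sub_inf_eq_posPart (a b : G) : a - a ⊓ b = (a - b)⁺ := by
  rw [posPart_def]
  apply le_antisymm
  · rw [sub_le_iff_le_add, add_inf]
    refine le_inf ?_ ?_
    · simp
    · simpa using add_le_add_left (le_sup_left : a - b ≤ (a - b) ⊔ 0) b
  · refine sup_le (sub_le_sub_left inf_le_right a) (sub_nonneg.2 inf_le_left)

lemma inf_add_le_add_right {h : G} (hh : 0 ≤ h) (a q : G) : a ⊓ (q + h) ≤ a ⊓ q + h := by
  rw [inf_add]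
  exact inf_le_inf_right _ (le_add_of_nonneg_right hh)

lemma nsmul_inf_le {a q : G} (ha : 0 ≤ a) (hq : 0 ≤ q) (n : ℕ) :
    (n • a) ⊓ q ≤ n • (a ⊓ q) := by
  induction n with
  | zero => simp
  | succ k ih =>
    have hk : 0 ≤ k • a := nsmul_nonneg ha k
    rw [succ_nsmul, succ_nsmul]
    refine le_trans ?_ (add_le_add_left ih _)
    rw [inf_add, add_inf, add_inf]
    refine le_inf (le_inf inf_le_left ?_) (le_inf ?_ ?_)
    · exact inf_le_right.trans (le_add_of_nonneg_left hk)
    · exact inf_le_right.trans (le_add_of_nonneg_right ha)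
    · exact inf_le_right.trans (le_add_of_nonneg_right hq)

/-- Dedekind completeness gives the Archimedean property: if `c` is the supremum of the multiples of
`a`, then `c - a` bounds them too. -/
lemma le_zero_of_forall_nsmul_le (hG : DedekindComplete G) {a b : G}
    (h : ∀ n : ℕ, n • a ≤ b) : a ≤ 0 := by
  obtain ⟨c, hc⟩ := hG (Set.range fun n : ℕ => n • a) (Set.range_nonempty _)
    ⟨b, by rintro _ ⟨n, rfl⟩; exact h n⟩
  have : c ≤ c - a := hc.2 (by
    rintro _ ⟨n, rfl⟩
    rw [le_sub_iff_add_le]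
    exact hc.1 ⟨n + 1, succ_nsmul a n⟩)
  simpa using this

end LatticeGroup

/-! ### Order closure and its algebraic stability. -/

section OrderClosure

/-- The smallest superset of `s` that is closed under the formation of suprema and infima of
non-empty sets. -/
inductive OrderClosure {G : Type*} [Lattice G] (s : Set G) : G → Prop
  | base {x : G} (hx : x ∈ s) : OrderClosure s x
  | sup {t : Set G} {a : G} (hne : t.Nonempty) (ht : ∀ x ∈ t, OrderClosure s x)
      (ha : IsLUB t a) : OrderClosure s a
  | inf {t : Set G} {a : G} (hne : t.Nonempty) (ht : ∀ x ∈ t, OrderClosure s x)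
      (ha : IsGLB t a) : OrderClosure s a

variable {G : Type*} [AddCommGroup G] [Lattice G] [IsOrderedAddMonoid G]

lemma OrderClosure.map {G : Type*} [Lattice G] {s s' : Set G} {φ : G → G}
    (hsup : ∀ (t : Set G) (a : G), t.Nonempty → IsLUB t a → IsLUB (φ '' t) (φ a))
    (hinf : ∀ (t : Set G) (a : G), t.Nonempty → IsGLB t a → IsGLB (φ '' t) (φ a))
    (hs : ∀ x ∈ s, OrderClosure s' (φ x)) {x : G} (hx : OrderClosure s x) :
    OrderClosure s' (φ x) := by
  induction hx with
  | base hx => exact hs _ hx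
  | sup hne _ ha ih =>
    exact .sup (hne.image φ) (by rintro _ ⟨x, hx, rfl⟩; exact ih x hx) (hsup _ _ hne ha)
  | inf hne _ ha ih =>
    exact .inf (hne.image φ) (by rintro _ ⟨x, hx, rfl⟩; exact ih x hx) (hinf _ _ hne ha)

lemma OrderClosure.map_orderIso {G : Type*} [Lattice G] {s s' : Set G} (φ : G ≃o G)
    (hs : ∀ x ∈ s, OrderClosure s' (φ x)) {x : G} (hx : OrderClosure s x) :
    OrderClosure s' (φ x) :=
  hx.map (fun _ _ _ h => φ.isLUB_image'.2 h) (fun _ _ _ h => φ.isGLB_image'.2 h) hs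

lemma OrderClosure.neg {s : Set G} (hs : ∀ x ∈ s, -x ∈ s) {x : G} (hx : OrderClosure s x) :
    OrderClosure s (-x) := by
  induction hx with
  | base hx => exact .base (hs _ hx)
  | sup hne _ ha ih =>
    exact .inf hne.neg (fun x hx => by simpa using ih (-x) hx) ha.neg
  | inf hne _ ha ih =>
    exact .sup hne.neg (fun x hx => by simpa using ih (-x) hx) ha.neg

lemma OrderClosure.add {s : Set G} (hs : ∀ x ∈ s, ∀ y ∈ s, x + y ∈ s) {x y : G}
    (hx : OrderClosure s x) (hy : OrderClosure s y) : OrderClosure s (x + y) := by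
  refine hx.map_orderIso (OrderIso.addRight y) fun z hz => ?_
  exact hy.map_orderIso (OrderIso.addLeft z) fun w hw => .base (hs z hz w hw)

lemma OrderClosure.sub {s : Set G} (hs : ∀ x ∈ s, ∀ y ∈ s, x + y ∈ s) (hneg : ∀ x ∈ s, -x ∈ s)
    {x y : G} (hx : OrderClosure s x) (hy : OrderClosure s y) : OrderClosure s (x - y) := by
  rw [sub_eq_add_neg]
  exact hx.add hs (hy.neg hneg)

lemma OrderClosure.sup_pair {G : Type*} [Lattice G] {s : Set G} {x y : G}
    (hx : OrderClosure s x) (hy : OrderClosure s y) : OrderClosure s (x ⊔ y) :=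
  .sup (Set.insert_nonempty x {y}) (by rintro _ (rfl | rfl) <;> assumption) isLUB_pair

lemma OrderClosure.inf_pair {G : Type*} [Lattice G] {s : Set G} {x y : G}
    (hx : OrderClosure s x) (hy : OrderClosure s y) : OrderClosure s (x ⊓ y) :=
  .inf (Set.insert_nonempty x {y}) (by rintro _ (rfl | rfl) <;> assumption) isGLB_pair

lemma OrderClosure.smul [Module ℝ G] [PosSMulMono ℝ G] {s : Set G}
    (hs : ∀ (c : ℝ), ∀ x ∈ s, c • x ∈ s) {x : G} (hx : OrderClosure s x) (c : ℝ) :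
    OrderClosure s (c • x) := by
  have hneg : ∀ x ∈ s, -x ∈ s := fun x hx => by simpa using hs (-1) x hx
  have pos : ∀ c : ℝ, 0 < c → OrderClosure s (c • x) := fun c hc =>
    hx.map_orderIso (OrderIso.smulRight hc) fun z hz => .base (hs c z hz)
  rcases lt_trichotomy c 0 with hc | rfl | hc
  · simpa using (pos (-c) (neg_pos.2 hc)).neg hneg
  -- Scaling by `0` is no order isomorphism; instead, descend through the non-empty sets to some `z
  -- ∈ s` and use `0 = 0 • z`.
  · have h := hs 0
    have : OrderClosure s ((0 : ℝ) • x) := by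
      rw [zero_smul]
      clear pos
      induction hx with
      | base hx => simpa using OrderClosure.base (h _ hx)
      | sup hne _ _ ih => exact ih _ hne.some_mem
      | inf hne _ _ ih => exact ih _ hne.some_mem
    exact this
  · exact pos c hc

end OrderClosure

/-! ### Unital `f`-algebras: approximating products by lattice operations. -/

section FAlg

variable {U : Type*} [Ring U] [Lattice U] [IsOrderedAddMonoid U]

lemma IsFAlgebra.mul_le_mul_left' (hU : IsFAlgebra U) {a b c : U} (hab : a ≤ b) (hc : 0 ≤ c) :
    c * a ≤ c * b := by
  have := hU.mul_nonneg c (b - a) hc (sub_nonneg.2 hab)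
  rwa [mul_sub, sub_nonneg] at this

lemma IsFAlgebra.mul_le_mul_right' (hU : IsFAlgebra U) {a b c : U} (hab : a ≤ b) (hc : 0 ≤ c) :
    a * c ≤ b * c := by
  have := hU.mul_nonneg (b - a) c (sub_nonneg.2 hab) hc
  rwa [sub_mul, sub_nonneg] at this

/-- In a unital `f`-algebra, multiplication by a positive element is an orthomorphism. -/
lemma IsFAlgebra.mul_inf_eq_zero (hU : IsFAlgebra U) (h1 : (0 : U) ≤ 1) {a b c : U}
    (ha : 0 ≤ a) (hb : 0 ≤ b) (hc : 0 ≤ c) (hab : a ⊓ b = 0) : (a * c) ⊓ b = 0 := by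
  -- The multiplier `c + 1` dominates both `c` and `1`, so one application covers `a * c` and `b *
  -- 1`.
  have h := (hU.disjoint_mul a b (c + 1) ha hb (add_nonneg hc h1) hab).1
  refine le_antisymm ?_ (le_inf (hU.mul_nonneg _ _ ha hc) hb)
  rw [← h, mul_add, mul_add, mul_one, mul_one]
  exact inf_le_inf (le_add_of_nonneg_right ha) (le_add_of_nonneg_left (hU.mul_nonneg _ _ hb hc))

lemma IsFAlgebra.le_zero_of_inf_one (hU : IsFAlgebra U) (h1 : (0 : U) ≤ 1) {d : U} (hd : 0 ≤ d)
    (h : d ⊓ 1 = 0) : d ≤ 0 := by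
  have := hU.mul_inf_eq_zero h1 h1 hd hd (by rwa [inf_comm])
  rw [one_mul, inf_idem] at this
  exact this.le

/-- The elements `(n - h)⁺` leave no room for a disjoint `d`: since `n ≤ (n - h)⁺ + h`, every
multiple `n • (d ⊓ 1)` stays below `h`. -/
lemma IsFAlgebra.le_zero_of_forall_inf (hU : IsFAlgebra U) (h1 : (0 : U) ≤ 1)
    (hD : DedekindComplete U) {d h : U} (hd : 0 ≤ d) (hh : 0 ≤ h)
    (H : ∀ n : ℕ, d ⊓ ((n : U) - h)⁺ ≤ 0) : d ≤ 0 := by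
  refine hU.le_zero_of_inf_one h1 hd (le_antisymm ?_ (le_inf hd h1))
  refine le_zero_of_forall_nsmul_le hD (b := h) fun n => ?_
  calc n • (d ⊓ 1) ≤ (n • d) ⊓ (((n : U) - h)⁺ + h) := by
        refine le_inf (nsmul_le_nsmul_right inf_le_left n) ?_
        refine (nsmul_le_nsmul_right inf_le_right n).trans ?_
        rw [nsmul_one, ← sub_le_iff_le_add]
        exact le_posPart _
    _ ≤ (n • d) ⊓ ((n : U) - h)⁺ + h := inf_add_le_add_right hh _ _
    _ ≤ n • (d ⊓ ((n : U) - h)⁺) + h := by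
        gcongr
        exact nsmul_inf_le hd (posPart_nonneg _) n
    _ ≤ n • (0 : U) + h := by
        gcongr
        exact H n
    _ = h := by simp

/-- Such a `d⁺` is disjoint from every `(n - h)⁺`, because `(h - n)⁺` is. This is the main tool for
showing that truncations at `n` converge. -/
lemma IsFAlgebra.le_zero_of_forall_le_posPart_mul (hU : IsFAlgebra U) (h1 : (0 : U) ≤ 1)
    (hD : DedekindComplete U) {d h y : U} (hh : 0 ≤ h) (hy : 0 ≤ y)
    (H : ∀ n : ℕ, d ≤ (h - (n : U))⁺ * y) : d ≤ 0 := by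
  refine (le_posPart d).trans
    (hU.le_zero_of_forall_inf h1 hD (posPart_nonneg d) hh fun n => ?_)
  have h0 : (h - (n : U))⁺ ⊓ ((n : U) - h)⁺ = 0 := by
    have := posPart_inf_negPart_eq_zero (h - (n : U))
    rwa [← posPart_neg, neg_sub] at this
  rw [← hU.mul_inf_eq_zero h1 (posPart_nonneg _) (posPart_nonneg _) hy h0]
  refine inf_le_inf_right _ (sup_le (H n) (hU.mul_nonneg _ _ (posPart_nonneg _) hy))

lemma IsFAlgebra.isLUB_inf_natCast_mul (hU : IsFAlgebra U) (h1 : (0 : U) ≤ 1)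
    (hD : DedekindComplete U) {h x : U} (hh : 0 ≤ h) (hx : 0 ≤ x) :
    IsLUB (Set.range fun n : ℕ => (h ⊓ (n : U)) * x) (h * x) := by
  constructor
  · rintro _ ⟨n, rfl⟩
    exact hU.mul_le_mul_right' inf_le_left hx
  · intro v hv
    rw [← sub_nonpos]
    refine hU.le_zero_of_forall_le_posPart_mul h1 hD hh hx fun n => ?_
    rw [← sub_inf_eq_posPart, sub_mul]
    exact sub_le_sub_left (hv ⟨n, rfl⟩) _

/-- If `f ≤ m` and `h f ≤ g`, then the positive part of `h m - g`, cut down by the component on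
which `h ≤ n`, is dominated by a multiple of `m - f`. -/
lemma IsFAlgebra.posPart_inf_le (hU : IsFAlgebra U) (h1 : (0 : U) ≤ 1) {f g h m : U}
    (hpos : 0 ≤ h) (hfm : f ≤ m) (hg : h * f ≤ g) (n : ℕ) :
    (h * m - g)⁺ ⊓ ((n : U) - h)⁺ ≤ (n : U) * (m - f) := by
  have hw : 0 ≤ m - f := sub_nonneg.2 hfm
  have h2 : (h * m - g)⁺ ≤ h * (m - f) := by
    refine sup_le ?_ (hU.mul_nonneg _ _ hpos hw)
    rw [mul_sub]
    exact sub_le_sub_left hg _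
  have h3 : h * (m - f) ≤ (n : U) * (m - f) + (h - n)⁺ * (m - f) := by
    rw [← add_mul, ← sub_inf_eq_posPart]
    refine hU.mul_le_mul_right' ?_ hw
    rw [← sub_le_iff_le_add, sub_sub_cancel]
    exact inf_le_right
  have h0 : (h - (n : U))⁺ ⊓ ((n : U) - h)⁺ = 0 := by
    have := posPart_inf_negPart_eq_zero (h - (n : U))
    rwa [← posPart_neg, neg_sub] at this
  have h4 := hU.mul_inf_eq_zero h1 (posPart_nonneg _) (posPart_nonneg _) hw h0
  have hn : (0 : U) ≤ n := by
    rw [← nsmul_one]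
    exact nsmul_nonneg h1 n
  -- The difference of the two sides lies below both `(h - n)⁺ * (m - f)` and `(n - h)⁺`, which are
  -- disjoint.
  rw [← sub_nonpos, ← h4]
  refine le_inf ?_ ?_
  · rw [sub_le_iff_le_add']
    exact inf_le_left.trans (h2.trans h3)
  · exact (sub_le_self _ (hU.mul_nonneg _ _ hn hw)).trans inf_le_right

variable [Algebra ℝ U] [PosSMulMono ℝ U]

/-- Induction along the grid `0, δ, 2δ, …`. With `w = x - Nδ`, the previous bound and the hypothesis
at the next grid point bound the error by `w⁺` and by `w⁻`, whose infimum is `0`. -/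
lemma le_add_posPart_of_forall_le_abs (h1 : (0 : U) ≤ 1) {d x : U} (hx : 0 ≤ x)
    (H : ∀ c : ℝ, d ≤ |x - c • 1|) {δ : ℝ} (hδ : 0 ≤ δ) (N : ℕ) :
    d ≤ δ • (1 : U) + (x - (N * δ) • (1 : U))⁺ := by
  induction N with
  | zero =>
    have := H 0
    rw [zero_smul, sub_zero, abs_of_nonneg hx] at this
    simp only [Nat.cast_zero, zero_mul, zero_smul, sub_zero]
    exact this.trans ((le_posPart x).trans (le_add_of_nonneg_left (smul_nonneg hδ h1)))
  | succ N ih =>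
    set t := x - ((N + 1 : ℕ) * δ) • (1 : U) with ht
    set w := x - (N * δ) • (1 : U) with hw
    have hwt : w = t + δ • (1 : U) := by
      rw [hw, ht]; push_cast; module
    have key : d - (δ • (1 : U) + t⁺) ≤ w⁺ ⊓ w⁻ := by
      refine le_inf ?_ ?_
      · rw [sub_le_iff_le_add]
        calc d ≤ δ • (1 : U) + w⁺ := ih
          _ ≤ w⁺ + (δ • (1 : U) + t⁺) := by
            rw [add_comm]
            gcongr
            exact le_add_of_nonneg_right (posPart_nonneg t)
      · have h2 := H ((N + 1 : ℕ) * δ)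
        rw [← ht, ← posPart_add_negPart] at h2
        have h3 : t⁻ ≤ w⁻ + δ • (1 : U) := by
          rw [negPart_def]
          refine sup_le ?_ (add_nonneg (negPart_nonneg w) (smul_nonneg hδ h1))
          have := neg_le_negPart w
          rw [hwt] at this ⊢
          calc -t = -(t + δ • (1 : U)) + δ • (1 : U) := by abel
            _ ≤ _ := by gcongr
        calc d - (δ • (1 : U) + t⁺) ≤ t⁺ + (w⁻ + δ • (1 : U)) - (δ • (1 : U) + t⁺) := by
              gcongr
              exact h2.trans (by gcongr)
          _ = w⁻ := by abel
    rw [posPart_inf_negPart_eq_zero, sub_nonpos] at key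
    exact key

/-- In an `f`-algebra with unit, `inf {|x - c| : c ∈ ℝ} = 0`. -/
lemma IsFAlgebra.le_zero_of_forall_le_abs (hU : IsFAlgebra U) (h1 : (0 : U) ≤ 1)
    (hD : DedekindComplete U) {d x : U} (hx : 0 ≤ x)
    (H : ∀ c : ℝ, d ≤ |x - c • 1|) : d ≤ 0 := by
  refine hU.le_zero_of_forall_le_posPart_mul h1 hD hx h1 fun M => ?_
  rw [mul_one, ← sub_nonpos]
  refine le_zero_of_forall_nsmul_le hD (b := 1) fun k => ?_
  rcases Nat.eq_zero_or_pos k with rfl | hk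
  · simpa using h1
  have hk' : (0 : ℝ) < k := Nat.cast_pos.2 hk
  -- Mesh `1 / k` with `M * k` steps ends the grid exactly at `M`.
  have h2 := le_add_posPart_of_forall_le_abs h1 hx H (inv_nonneg.2 hk'.le) (M * k)
  have h3 : (((M * k : ℕ) : ℝ) * (k : ℝ)⁻¹) • (1 : U) = (M : U) := by
    have : (((M * k : ℕ) : ℝ) * (k : ℝ)⁻¹) = M := by push_cast; field_simp
    rw [this, Nat.cast_smul_eq_nsmul, nsmul_one]
  rw [h3, ← sub_le_iff_le_add] at h2
  calc k • (d - (x - (M : U))⁺) ≤ k • ((k : ℝ)⁻¹ • (1 : U)) := nsmul_le_nsmul_right h2 k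
    _ = 1 := by rw [← Nat.cast_smul_eq_nsmul ℝ, smul_inv_smul₀ hk'.ne']

/-- Expand `x` around `c`: dropping `h * (x - c)⁺` and replacing `h` by `n` in front of `(x - c)⁻`
loses at most `n * |x - c|`, and these gaps have infimum `0` over `c`. The approximants involve no
product with `x`. -/
lemma IsFAlgebra.isLUB_mul_of_le (hU : IsFAlgebra U) (h1 : (0 : U) ≤ 1)
    (hD : DedekindComplete U) {h x : U} (hh : 0 ≤ h) (hx : 0 ≤ x) {n : ℕ} (hn : h ≤ n) :
    IsLUB (Set.range fun c : ℝ => c • h - (n : ℝ) • (x - c • 1)⁻) (h * x) := by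
  have hsplit : ∀ c : ℝ, h * x = c • h + h * (x - c • 1)⁺ - h * (x - c • 1)⁻ := fun c => by
    rw [add_sub_assoc, ← mul_sub, posPart_sub_negPart, mul_sub, mul_smul_comm, mul_one]
    abel
  have hle : ∀ y : U, 0 ≤ y → h * y ≤ (n : ℝ) • y := fun y hy => by
    rw [Nat.cast_smul_eq_nsmul, nsmul_eq_mul]
    exact hU.mul_le_mul_right' hn hy
  constructor
  · rintro _ ⟨c, rfl⟩
    change c • h - (n : ℝ) • (x - c • 1)⁻ ≤ h * x
    rw [hsplit c]
    have h2 := hle _ (negPart_nonneg (x - c • (1 : U)))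
    have h3 := hU.mul_nonneg h _ hh (posPart_nonneg (x - c • (1 : U)))
    exact sub_le_sub (le_add_of_nonneg_right h3) h2
  · intro v hv
    -- Dividing by `n + 1` rather than `n` also covers `n = 0`.
    have hn1 : (0 : ℝ) < (n + 1 : ℕ) := by positivity
    have key : ((n + 1 : ℕ) : ℝ)⁻¹ • (h * x - v) ≤ 0 := by
      refine hU.le_zero_of_forall_le_abs h1 hD hx fun c => ?_
      rw [inv_smul_le_iff_of_pos hn1]
      have h2 : c • h - (n : ℝ) • (x - c • 1)⁻ ≤ v := hv ⟨c, rfl⟩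
      have h3 := hle _ (posPart_nonneg (x - c • (1 : U)))
      have h4 := hU.mul_nonneg h _ hh (negPart_nonneg (x - c • (1 : U)))
      rw [hsplit c, ← posPart_add_negPart]
      calc c • h + h * (x - c • 1)⁺ - h * (x - c • 1)⁻ - v
          ≤ c • h + (n : ℝ) • (x - c • 1)⁺ - 0 - (c • h - (n : ℝ) • (x - c • 1)⁻) := by gcongr
        _ = (n : ℝ) • ((x - c • 1)⁺ + (x - c • 1)⁻) := by module
        _ ≤ ((n + 1 : ℕ) : ℝ) • ((x - c • 1)⁺ + (x - c • 1)⁻) := by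
            refine smul_le_smul_of_nonneg_right (by push_cast; linarith) ?_
            exact add_nonneg (posPart_nonneg _) (negPart_nonneg _)
    rw [inv_smul_le_iff_of_pos hn1, smul_zero, sub_nonpos] at key
    exact key

lemma IsFAlgebra.orderClosure_mul (hU : IsFAlgebra U) (h1 : (0 : U) ≤ 1)
    (hD : DedekindComplete U) {S : Submodule ℝ U} (hS : (1 : U) ∈ S) {h x : U}
    (hh : 0 ≤ h) (hx : 0 ≤ x) (hhS : OrderClosure (S : Set U) h)
    (hxS : OrderClosure (S : Set U) x) : OrderClosure (S : Set U) (h * x) := by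
  have hadd : ∀ x ∈ (S : Set U), ∀ y ∈ (S : Set U), x + y ∈ (S : Set U) :=
    fun x hx y hy => S.add_mem hx hy
  have hneg : ∀ x ∈ (S : Set U), -x ∈ (S : Set U) := fun x hx => S.neg_mem hx
  have hsmul : ∀ c : ℝ, ∀ x ∈ (S : Set U), c • x ∈ (S : Set U) := fun c x hx => S.smul_mem c hx
  have hcast : ∀ n : ℕ, (n : U) ∈ S := fun n => by
    rw [← nsmul_one, ← Nat.cast_smul_eq_nsmul ℝ]
    exact S.smul_mem _ hS
  refine .sup (Set.range_nonempty _) ?_ (hU.isLUB_inf_natCast_mul h1 hD hh hx)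
  rintro _ ⟨n, rfl⟩
  have hn : (0 : U) ≤ n := by
    rw [← nsmul_one]
    exact nsmul_nonneg h1 n
  refine .sup (Set.range_nonempty _) ?_
    (hU.isLUB_mul_of_le h1 hD (le_inf hh hn) hx (n := n) inf_le_right)
  rintro _ ⟨c, rfl⟩
  refine .sub hadd hneg ((hhS.inf_pair (.base (hcast n))).smul hsmul c) (.smul hsmul ?_ _)
  refine .sup_pair (.neg hneg (.sub hadd hneg hxS (.base (S.smul_mem c hS)))) (.base S.zero_mem)

end FAlg

/-! ### Order dense embeddings preserve suprema and infima. -/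

section Embedding

variable {E U : Type*} [AddCommGroup E] [Lattice E] [IsOrderedAddMonoid E] [Module ℝ E]
  [AddCommGroup U] [Lattice U] [IsOrderedAddMonoid U] [Module ℝ U] {ι : E →ₗ[ℝ] U}

lemma IsUniversalCompletion.le_iff (hι : IsUniversalCompletion ι) {x y : E} :
    ι x ≤ ι y ↔ x ≤ y := by
  rw [← sup_eq_right, ← hι.map_sup, hι.injective.eq_iff, sup_eq_right]

lemma IsUniversalCompletion.map_inf (hι : IsUniversalCompletion ι) (x y : E) :
    ι (x ⊓ y) = ι x ⊓ ι y := by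
  have h1 : x ⊓ y = x + y - x ⊔ y := eq_sub_of_add_eq (inf_add_sup x y)
  have h2 : ι x ⊓ ι y = ι x + ι y - ι x ⊔ ι y := eq_sub_of_add_eq (inf_add_sup _ _)
  rw [h1, h2, map_sub, map_add, hι.map_sup]

lemma IsUniversalCompletion.isLUB_image (hι : IsUniversalCompletion ι) {s : Set E} {b : E}
    (hb : IsLUB s b) : IsLUB (ι '' s) (ι b) := by
  constructor
  · rintro _ ⟨x, hx, rfl⟩
    exact hι.le_iff.2 (hb.1 hx)
  · intro v hv
    by_contra hlt
    have hpos : 0 < ι b - ι b ⊓ v :=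
      lt_of_le_of_ne (sub_nonneg.2 inf_le_left) fun h =>
        hlt (inf_eq_left.1 (sub_eq_zero.1 h.symm).symm)
    -- Order density puts an element of `E` in the gap, so `b - x` would be a smaller upper bound of
    -- `s`.
    obtain ⟨x, hx0, hx⟩ := hι.orderDense _ hpos
    have hle : b ≤ b - x := hb.2 fun w hw => by
      rw [← hι.le_iff, map_sub]
      calc ι w ≤ ι b ⊓ v := le_inf (hι.le_iff.2 (hb.1 hw)) (hv ⟨w, hw, rfl⟩)
        _ ≤ ι b - ι x := by rwa [le_sub_comm]
    have hx' : x ≤ 0 := by simpa using hle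
    rw [← hι.le_iff, map_zero] at hx'
    exact absurd hx0 hx'.not_gt

lemma IsUniversalCompletion.isGLB_image (hι : IsUniversalCompletion ι) {s : Set E} {b : E}
    (hb : IsGLB s b) : IsGLB (ι '' s) (ι b) := by
  have h := (hι.isLUB_image hb.neg).neg
  rw [map_neg, neg_neg] at h
  convert h using 1
  ext x
  simp only [Set.mem_image, Set.mem_neg]
  constructor
  · rintro ⟨y, hy, rfl⟩
    exact ⟨-y, by simpa using hy, map_neg ι y⟩
  · rintro ⟨y, hy, hxy⟩
    exact ⟨-y, hy, by rw [map_neg, hxy, neg_neg]⟩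

end Embedding

/-! ### Fixed points of a conditional expectation. -/

section ConditionalExpectation

variable {E : Type*} [AddCommGroup E] [Lattice E] [IsOrderedAddMonoid E] [Module ℝ E]
  {e : E} {F : E →ₗ[ℝ] E}

lemma IsConditionalExpectation.nonneg (hF : IsConditionalExpectation e F) {x : E} (hx : 0 ≤ x) :
    0 ≤ F x := by
  rcases hx.eq_or_lt with rfl | h
  · simp
  · exact (hF.strictlyPositive x h).le

lemma IsConditionalExpectation.mono (hF : IsConditionalExpectation e F) {x y : E} (h : x ≤ y) :
    F x ≤ F y := by
  have := hF.nonneg (sub_nonneg.2 h)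
  rwa [map_sub, sub_nonneg] at this

/-- `F` annihilates the positive element `F x - x`, so strict positivity makes it zero. -/
lemma IsConditionalExpectation.map_eq_self_of_le (hF : IsConditionalExpectation e F) {x : E}
    (h : x ≤ F x) : F x = x := by
  by_contra hne
  have hlt : 0 < F x - x := sub_pos.2 (lt_of_le_of_ne h (Ne.symm hne))
  have := hF.strictlyPositive _ hlt
  rw [map_sub, hF.idem, sub_self] at this
  exact lt_irrefl _ this

lemma IsConditionalExpectation.map_isLUB (hF : IsConditionalExpectation e F) {s : Set E} {b : E}
    (hs : ∀ x ∈ s, F x = x) (hb : IsLUB s b) : F b = b :=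
  hF.map_eq_self_of_le (hb.2 fun x hx => (hs x hx).symm.le.trans (hF.mono (hb.1 hx)))

end ConditionalExpectation

/-! ### Truncations of the order closure of the range. -/

section Range

variable {E U : Type*} [AddCommGroup E] [Lattice E] [IsOrderedAddMonoid E] [Module ℝ E]
  [AddCommGroup U] [Lattice U] [IsOrderedAddMonoid U] [Module ℝ U]
  {ι : E →ₗ[ℝ] U} {e : E} {F : E →ₗ[ℝ] E}

lemma IsConditionalExpectation.exists_fixed (hF : IsConditionalExpectation e F) {y : U}
    (hy : y ∈ LinearMap.range (ι ∘ₗ F)) : ∃ x, F x = x ∧ ι x = y := by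
  obtain ⟨z, rfl⟩ := hy
  exact ⟨F z, hF.idem z, rfl⟩

lemma mem_range_of_fixed {x : E} (hx : F x = x) : ι x ∈ LinearMap.range (ι ∘ₗ F) :=
  ⟨x, by simp [hx]⟩

lemma IsConditionalRieszTriple.isLUB_mem_range (hF : IsConditionalRieszTriple e F)
    (hι : IsUniversalCompletion ι) {t : Set U} {a : U} {w : E} (hne : t.Nonempty)
    (ht : ∀ x ∈ t, x ∈ LinearMap.range (ι ∘ₗ F)) (ha : IsLUB t a) (haw : a ≤ ι w) :
    a ∈ LinearMap.range (ι ∘ₗ F) := by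
  set s : Set E := {x | F x = x ∧ ι x ∈ t} with hs
  have hst : ι '' s = t := by
    ext y
    constructor
    · rintro ⟨x, hx, rfl⟩
      exact hx.2
    · intro hy
      obtain ⟨x, hx, rfl⟩ := hF.condExp.exists_fixed (ht y hy)
      exact ⟨x, ⟨hx, hy⟩, rfl⟩
  have hsne : s.Nonempty := by rwa [← hst, Set.image_nonempty] at hne
  obtain ⟨b, hb⟩ := hF.complete s hsne
    ⟨w, fun x hx => hι.le_iff.1 ((ha.1 hx.2).trans haw)⟩
  have h2 := hι.isLUB_image hb
  rw [hst] at h2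
  rw [ha.unique h2]
  exact mem_range_of_fixed (hF.condExp.map_isLUB (fun x hx => hx.1) hb)

lemma IsConditionalRieszTriple.isGLB_mem_range (hF : IsConditionalRieszTriple e F)
    (hι : IsUniversalCompletion ι) {t : Set U} {a : U} {w : E} (hne : t.Nonempty)
    (ht : ∀ x ∈ t, x ∈ LinearMap.range (ι ∘ₗ F)) (ha : IsGLB t a) (haw : ι w ≤ a) :
    a ∈ LinearMap.range (ι ∘ₗ F) := by
  rw [← neg_mem_iff]
  refine hF.isLUB_mem_range hι (w := -w) hne.neg (fun x hx => ?_) ha.neg ?_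
  · rw [← neg_mem_iff]
    exact ht _ hx
  · rw [map_neg]
    exact neg_le_neg haw

lemma IsConditionalRieszTriple.sup_mem_range (hF : IsConditionalRieszTriple e F)
    (hι : IsUniversalCompletion ι) {x y : U} (hx : x ∈ LinearMap.range (ι ∘ₗ F))
    (hy : y ∈ LinearMap.range (ι ∘ₗ F)) : x ⊔ y ∈ LinearMap.range (ι ∘ₗ F) := by
  obtain ⟨x, hx, rfl⟩ := hF.condExp.exists_fixed hx
  obtain ⟨y, hy, rfl⟩ := hF.condExp.exists_fixed hy
  rw [← hι.map_sup]
  refine mem_range_of_fixed (hF.condExp.map_isLUB (s := {x, y}) ?_ isLUB_pair)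
  rintro _ (rfl | rfl) <;> assumption

lemma IsConditionalRieszTriple.inf_mem_range (hF : IsConditionalRieszTriple e F)
    (hι : IsUniversalCompletion ι) {x y : U} (hx : x ∈ LinearMap.range (ι ∘ₗ F))
    (hy : y ∈ LinearMap.range (ι ∘ₗ F)) : x ⊓ y ∈ LinearMap.range (ι ∘ₗ F) := by
  rw [eq_sub_of_add_eq (inf_add_sup x y)]
  exact sub_mem (add_mem hx hy) (hF.sup_mem_range hι hx hy)

/-- Truncation commutes with suprema and infima and keeps them between elements of `E`, where the
range of `F` is closed. Both bounds are needed: the elements met in the induction may have any sign.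
-/
lemma IsConditionalRieszTriple.truncation_mem_range (hF : IsConditionalRieszTriple e F)
    (hι : IsUniversalCompletion ι) {y : U}
    (hy : OrderClosure (LinearMap.range (ι ∘ₗ F) : Set U) y) (n m : ℕ) :
    (y ⊓ ι (n • e)) ⊔ ι (-(m • e)) ∈ LinearMap.range (ι ∘ₗ F) := by
  have hfix : ∀ k : ℕ, F (k • e) = k • e := fun k => by rw [map_nsmul, hF.condExp.map_unit]
  have hk : ∀ k : ℕ, 0 ≤ k • e := fun k => nsmul_nonneg hF.unit.nonneg k
  have hle : ι (-(m • e)) ≤ ι (n • e) :=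
    hι.le_iff.2 ((neg_nonpos.2 (hk m)).trans (hk n))
  induction hy with
  | base hx =>
    refine hF.sup_mem_range hι (hF.inf_mem_range hι hx (mem_range_of_fixed (hfix n))) ?_
    exact mem_range_of_fixed (by rw [map_neg, hfix])
  | sup hne _ ha ih =>
    have h1 := isLUB_sup_const (hne.image _) (isLUB_inf_const ha (ι (n • e))) (ι (-(m • e)))
    refine hF.isLUB_mem_range hι (w := n • e) ((hne.image _).image _) ?_ h1
      (sup_le inf_le_right hle)
    rintro _ ⟨_, ⟨x, hx, rfl⟩, rfl⟩
    exact ih x hx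
  | inf hne _ ha ih =>
    have h1 := isGLB_sup_const (isGLB_inf_const hne ha (ι (n • e))) (ι (-(m • e)))
    refine hF.isGLB_mem_range hι (w := -(m • e)) ((hne.image _).image _) ?_ h1 le_sup_right
    rintro _ ⟨_, ⟨x, hx, rfl⟩, rfl⟩
    exact ih x hx

lemma IsConditionalRieszTriple.inf_unit_mem_range (hF : IsConditionalRieszTriple e F)
    (hι : IsUniversalCompletion ι) {y : U} (hy0 : 0 ≤ y)
    (hy : OrderClosure (LinearMap.range (ι ∘ₗ F) : Set U) y) (n : ℕ) :
    y ⊓ ι (n • e) ∈ LinearMap.range (ι ∘ₗ F) := by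
  have h := hF.truncation_mem_range hι hy n 0
  have h0 : 0 ≤ ι (n • e) := by
    rw [← map_zero ι]
    exact hι.le_iff.2 (nsmul_nonneg hF.unit.nonneg n)
  rwa [zero_smul, neg_zero, map_zero, sup_eq_left.2 (le_inf hy0 h0)] at h

end Range

/-! ### The extended operator, its range and the averaging identity. -/

section NaturalDomain

variable {E U : Type*}
  [AddCommGroup E] [Lattice E] [IsOrderedAddMonoid E] [Module ℝ E]
  [Ring U] [Lattice U] [IsOrderedAddMonoid U] [Algebra ℝ U]
  {e : E} {F : E →ₗ[ℝ] E} {ι : E →ₗ[ℝ] U}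

lemma map_nsmul_unit (hunit : ι e = 1) (n : ℕ) : ι (n • e) = (n : U) := by
  rw [map_nsmul, hunit, nsmul_one]

lemma IsConditionalRieszTriple.zero_le_one (hF : IsConditionalRieszTriple e F)
    (hι : IsUniversalCompletion ι) (hunit : ι e = 1) : (0 : U) ≤ 1 := by
  rw [← hunit, ← map_zero ι]
  exact hι.le_iff.2 hF.unit.nonneg

lemma IsUniversalCompletion.isGLB_posPart_sub_nsmul (hι : IsUniversalCompletion ι)
    (hU : IsFAlgebra U) (h1 : (0 : U) ≤ 1) (hunit : ι e = 1) {z : E} (hz : 0 ≤ z) :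
    IsGLB (Set.range fun n : ℕ => z - z ⊓ n • e) 0 := by
  constructor
  · rintro _ ⟨n, rfl⟩
    exact sub_nonneg.2 inf_le_left
  · intro d hd
    rw [← hι.le_iff, map_zero]
    have hz' : 0 ≤ ι z := by
      rw [← map_zero ι]
      exact hι.le_iff.2 hz
    refine hU.le_zero_of_forall_le_posPart_mul h1 hι.dedekindComplete hz' h1 fun n => ?_
    have h2 : d ≤ z - z ⊓ n • e := hd ⟨n, rfl⟩
    rw [← hι.le_iff, map_sub, hι.map_inf, map_nsmul_unit hunit, sub_inf_eq_posPart] at h2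
    rwa [mul_one]

/-- The truncation of `y` at `n • e` is fixed by `F` and dominates that of `z`, so `F (z ⊓ n • e)`
lies below `y`; order continuity removes the truncation. -/
lemma IsConditionalRieszTriple.map_le_of_le (hF : IsConditionalRieszTriple e F)
    (hι : IsUniversalCompletion ι) (hU : IsFAlgebra U) (hunit : ι e = 1) {y : U} {z : E}
    (hy : OrderClosure (LinearMap.range (ι ∘ₗ F) : Set U) y) (hz : 0 ≤ z) (hzy : ι z ≤ y) :
    ι (F z) ≤ y := by
  have h1 := hF.zero_le_one hι hunit
  have hy0 : 0 ≤ y := by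
    refine le_trans ?_ hzy
    rw [← map_zero ι]
    exact hι.le_iff.2 hz
  have hglb := hι.isGLB_posPart_sub_nsmul hU h1 hunit hz
  have hdir : DirectedOn (fun x y => y ≤ x) (Set.range fun n : ℕ => z - z ⊓ n • e) := by
    rintro _ ⟨n, rfl⟩ _ ⟨m, rfl⟩
    have hmono : ∀ k, k ≤ max n m → z - z ⊓ (max n m) • e ≤ z - z ⊓ k • e := fun k hk =>
      sub_le_sub_left (inf_le_inf_left z (nsmul_le_nsmul_left hF.unit.nonneg hk)) z
    exact ⟨_, ⟨max n m, rfl⟩, hmono n (le_max_left n m), hmono m (le_max_right n m)⟩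
  have h2 := hι.isGLB_image (hF.condExp.orderContinuous _ (Set.range_nonempty _) hdir hglb)
  rw [map_zero] at h2
  rw [← sub_nonpos]
  refine h2.2 ?_
  rintro _ ⟨_, ⟨_, ⟨n, rfl⟩, rfl⟩, rfl⟩
  obtain ⟨w, hw, hwy⟩ := hF.condExp.exists_fixed (hF.inf_unit_mem_range hι hy0 hy n)
  have h3 : F (z ⊓ n • e) ≤ w := by
    rw [← hw]
    refine hF.condExp.mono (hι.le_iff.1 ?_)
    rw [hwy, hι.map_inf]
    exact inf_le_inf_right _ hzy
  have h4 : ι (F (z ⊓ n • e)) ≤ y := (hι.le_iff.2 h3).trans (hwy.le.trans inf_le_left)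
  rw [map_sub, map_sub]
  exact sub_le_sub_left h4 _

lemma IsConditionalRieszTriple.extendsPos_self (hF : IsConditionalRieszTriple e F)
    (hι : IsUniversalCompletion ι) (hU : IsFAlgebra U) (hunit : ι e = 1) {y : U} (hy0 : 0 ≤ y)
    (hy : OrderClosure (LinearMap.range (ι ∘ₗ F) : Set U) y) : ExtendsPos ι F y y := by
  have h1 := hF.zero_le_one hι hunit
  constructor
  · rintro _ ⟨z, hz, hzy, rfl⟩
    exact hF.map_le_of_le hι hU hunit hy hz hzy
  · intro v hv
    rw [← sub_nonpos]
    refine hU.le_zero_of_forall_le_posPart_mul h1 hι.dedekindComplete hy0 h1 fun n => ?_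
    rw [mul_one, ← sub_inf_eq_posPart, ← map_nsmul_unit hunit]
    refine sub_le_sub_left (hv ?_) y
    obtain ⟨w, hw, hwy⟩ := hF.condExp.exists_fixed (hF.inf_unit_mem_range hι hy0 hy n)
    refine ⟨w, ?_, hwy.le.trans inf_le_left, by rw [hw, hwy]⟩
    rw [← hι.le_iff, hwy, map_zero, map_nsmul, hunit]
    exact le_inf hy0 (nsmul_nonneg h1 n)

lemma ExtendsPos.orderClosure {x y : U} (hx : 0 ≤ x) (h : ExtendsPos ι F x y) :
    OrderClosure (LinearMap.range (ι ∘ₗ F) : Set U) y := by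
  have hne : {w : U | ∃ z : E, 0 ≤ z ∧ ι z ≤ x ∧ w = ι (F z)}.Nonempty :=
    ⟨0, 0, le_rfl, by rwa [map_zero], by simp⟩
  refine .sup hne ?_ h
  rintro _ ⟨z, _, _, rfl⟩
  exact .base ⟨z, rfl⟩

/-- The range of the extended conditional expectation is the order closure of the range of the
conditional expectation. -/
lemma IsConditionalRieszTriple.mem_R_iff (hF : IsConditionalRieszTriple e F)
    (hι : IsUniversalCompletion ι) (hU : IsFAlgebra U) (hunit : ι e = 1) {y : U} :
    y ∈ R ι F ↔ OrderClosure (LinearMap.range (ι ∘ₗ F) : Set U) y := by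
  constructor
  · rintro ⟨x, y₁, y₂, h₁, h₂, rfl⟩
    exact .sub (fun _ hx _ hy => add_mem hx hy) (fun _ hx => neg_mem hx)
      (h₁.orderClosure (posPart_nonneg x)) (h₂.orderClosure (negPart_nonneg x))
  · intro hy
    have h0 : OrderClosure (LinearMap.range (ι ∘ₗ F) : Set U) 0 := .base (zero_mem _)
    refine ⟨y, y⁺, y⁻, ?_, ?_, (posPart_sub_negPart y).symm⟩
    · exact hF.extendsPos_self hι hU hunit (posPart_nonneg y) (hy.sup_pair h0)
    · exact hF.extendsPos_self hι hU hunit (negPart_nonneg y)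
        ((hy.neg fun _ hx => neg_mem hx).sup_pair h0)

lemma IsConditionalRieszTriple.mem_L1_of_abs_le (hF : IsConditionalRieszTriple e F)
    (hι : IsUniversalCompletion ι) (hU : IsFAlgebra U) (hunit : ι e = 1) {x u : U}
    (hu : u ∈ R ι F) (hxu : |x| ≤ u) : x ∈ L1 ι F := by
  rw [hF.mem_R_iff hι hU hunit] at hu
  have key : ∀ v : U, 0 ≤ v → v ≤ u → ∃ y, ExtendsPos ι F v y := fun v hv hvu =>
    hι.dedekindComplete _ ⟨0, 0, le_rfl, by rwa [map_zero], by simp⟩ ⟨u, by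
      rintro _ ⟨z, hz, hzv, rfl⟩
      exact hF.map_le_of_le hι hU hunit hu hz (hzv.trans hvu)⟩
  rw [← posPart_add_negPart] at hxu
  obtain ⟨y₁, h₁⟩ := key x⁺ (posPart_nonneg x)
    ((le_add_of_nonneg_right (negPart_nonneg x)).trans hxu)
  obtain ⟨y₂, h₂⟩ := key x⁻ (negPart_nonneg x)
    ((le_add_of_nonneg_left (posPart_nonneg x)).trans hxu)
  exact ⟨_, y₁, y₂, h₁, h₂, rfl⟩

lemma condSup_eq {f m : U} (hm : IsGLB {g | g ∈ R ι F ∧ f ≤ g} m) : condSup ι F f = m := by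
  have hex : ∃ m, IsGLB {g | g ∈ R ι F ∧ f ≤ g} m := ⟨m, hm⟩
  rw [condSup, dif_pos hex]
  exact hex.choose_spec.unique hm

lemma IsConditionalRieszTriple.condSup_spec (hF : IsConditionalRieszTriple e F)
    (hι : IsUniversalCompletion ι) (hU : IsFAlgebra U) (hunit : ι e = 1) {f : U}
    (hf : f ∈ LInfty ι F) :
    condSup ι F f ∈ R ι F ∧ IsGLB {g | g ∈ R ι F ∧ f ≤ g} (condSup ι F f) := by
  obtain ⟨_, u, hu, hfu⟩ := hf
  have hne : {g | g ∈ R ι F ∧ f ≤ g}.Nonempty := ⟨u, hu, (le_abs_self f).trans hfu⟩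
  obtain ⟨m, hm⟩ : ∃ m, IsGLB {g | g ∈ R ι F ∧ f ≤ g} m := by
    -- `DedekindComplete` speaks of suprema, so it is applied to the negated set, bounded above by
    -- `-f`.
    obtain ⟨c, hc⟩ := hι.dedekindComplete (-{g | g ∈ R ι F ∧ f ≤ g}) hne.neg
      ⟨-f, fun x hx => le_neg_of_le_neg hx.2⟩
    exact ⟨-c, isLUB_neg.1 (by simpa using hc)⟩
  rw [condSup_eq hm]
  refine ⟨?_, hm⟩
  rw [hF.mem_R_iff hι hU hunit]
  exact .inf hne (fun x hx => (hF.mem_R_iff hι hU hunit).1 hx.1) hm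

variable [PosSMulMono ℝ U]

lemma IsConditionalRieszTriple.mul_mem_R (hF : IsConditionalRieszTriple e F)
    (hι : IsUniversalCompletion ι) (hU : IsFAlgebra U) (hunit : ι e = 1) {h x : U}
    (hh : h ∈ R ι F) (hx : x ∈ R ι F) (hpos : 0 ≤ h) : h * x ∈ R ι F := by
  have h1 := hF.zero_le_one hι hunit
  have hS : (1 : U) ∈ LinearMap.range (ι ∘ₗ F) := by
    rw [← hunit]
    exact mem_range_of_fixed hF.condExp.map_unit
  rw [hF.mem_R_iff hι hU hunit] at hh hx ⊢
  have h0 : OrderClosure (LinearMap.range (ι ∘ₗ F) : Set U) 0 := .base (zero_mem _)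
  have hD := hι.dedekindComplete
  rw [← posPart_sub_negPart x, mul_sub]
  refine .sub (fun _ hx _ hy => add_mem hx hy) (fun _ hx => neg_mem hx) ?_ ?_
  · exact hU.orderClosure_mul h1 hD hS hpos (posPart_nonneg x) hh (hx.sup_pair h0)
  · exact hU.orderClosure_mul h1 hD hS hpos (negPart_nonneg x) hh
      ((hx.neg fun _ hx => neg_mem hx).sup_pair h0)

lemma IsConditionalRieszTriple.mul_mem_LInfty (hF : IsConditionalRieszTriple e F)
    (hι : IsUniversalCompletion ι) (hU : IsFAlgebra U) (hunit : ι e = 1) {h f : U}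
    (hf : f ∈ LInfty ι F) (hh : h ∈ R ι F) (hpos : 0 ≤ h) : h * f ∈ LInfty ι F := by
  obtain ⟨_, u, hu, hfu⟩ := hf
  have hhu := hF.mul_mem_R hι hU hunit hh hu hpos
  have hle : |h * f| ≤ h * u := by
    refine abs_le'.2 ⟨hU.mul_le_mul_left' ((le_abs_self f).trans hfu) hpos, ?_⟩
    rw [← mul_neg]
    exact hU.mul_le_mul_left' ((neg_le_abs f).trans hfu) hpos
  exact ⟨hF.mem_L1_of_abs_le hι hU hunit hhu hle, _, hhu, hle⟩

lemma IsConditionalRieszTriple.isGLB_mul (hF : IsConditionalRieszTriple e F)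
    (hι : IsUniversalCompletion ι) (hU : IsFAlgebra U) (hunit : ι e = 1) {f h m : U}
    (hh : h ∈ R ι F) (hpos : 0 ≤ h) (hmR : m ∈ R ι F)
    (hm : IsGLB {g | g ∈ R ι F ∧ f ≤ g} m) :
    IsGLB {g | g ∈ R ι F ∧ h * f ≤ g} (h * m) := by
  have h1 := hF.zero_le_one hι hunit
  have hfm : f ≤ m := hm.2 fun g hg => hg.2
  have hmul := hF.mul_mem_R hι hU hunit hh hmR hpos
  -- `h * m` itself belongs to the set, so only its being a lower bound needs work.
  refine ⟨fun g hg => ?_, fun v hv => hv ⟨hmul, hU.mul_le_mul_left' hfm hpos⟩⟩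
  obtain ⟨hgR, hg⟩ := hg
  rw [← sub_nonpos]
  refine (le_posPart _).trans
    (hU.le_zero_of_forall_inf h1 hι.dedekindComplete (posPart_nonneg _) hpos fun n => ?_)
  set z := (h * m - g)⁺ ⊓ ((n : U) - h)⁺ with hz
  have hzw : z ≤ (n : U) * (m - f) := hU.posPart_inf_le h1 hpos hfm hg n
  -- For `n = 0` the bound already reads `z ≤ 0`; otherwise division by `n` is allowed.
  rcases Nat.eq_zero_or_pos n with rfl | hn
  · simpa using hzw
  have hn' : (0 : ℝ) < n := Nat.cast_pos.2 hn
  have hadd : ∀ x ∈ (LinearMap.range (ι ∘ₗ F) : Set U), ∀ y ∈ (LinearMap.range (ι ∘ₗ F) : Set U),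
      x + y ∈ (LinearMap.range (ι ∘ₗ F) : Set U) := fun _ hx _ hy => add_mem hx hy
  have hneg : ∀ x ∈ (LinearMap.range (ι ∘ₗ F) : Set U),
      -x ∈ (LinearMap.range (ι ∘ₗ F) : Set U) := fun _ hx => neg_mem hx
  have hcast : OrderClosure (LinearMap.range (ι ∘ₗ F) : Set U) (n : U) := by
    rw [← map_nsmul_unit hunit]
    exact .base (mem_range_of_fixed (by rw [map_nsmul, hF.condExp.map_unit]))
  have hmem : m - (n : ℝ)⁻¹ • z ∈ R ι F := by
    rw [hF.mem_R_iff hι hU hunit] at hmR hgR hh hmul ⊢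
    have h0 : OrderClosure (LinearMap.range (ι ∘ₗ F) : Set U) 0 := .base (zero_mem _)
    refine hmR.sub hadd hneg (.smul (fun c x hx => Submodule.smul_mem _ c hx) ?_ _)
    exact ((hmul.sub hadd hneg hgR).sup_pair h0).inf_pair
      ((hcast.sub hadd hneg hh).sup_pair h0)
  have hle : f ≤ m - (n : ℝ)⁻¹ • z := by
    rw [le_sub_comm, inv_smul_le_iff_of_pos hn', Nat.cast_smul_eq_nsmul, nsmul_eq_mul]
    exact hzw
  -- Minimality of `m` against the smaller competitor `m - z / n`.
  have := hm.1 ⟨hmem, hle⟩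
  rw [le_sub_self_iff, inv_smul_le_iff_of_pos hn', smul_zero] at this
  exact this

end NaturalDomain

end RieszCond

theorem mainTheorem1
    {E U : Type*}
    [AddCommGroup E] [Lattice E] [IsOrderedAddMonoid E] [Module ℝ E] [PosSMulMono ℝ E]
    [Ring U] [Lattice U] [IsOrderedAddMonoid U] [Algebra ℝ U] [PosSMulMono ℝ U]
    (e : E) (F : E →ₗ[ℝ] E) (hF : RieszCond.IsConditionalRieszTriple e F)
    (ι : E →ₗ[ℝ] U) (hι : RieszCond.IsUniversalCompletion ι)
    (hU : RieszCond.IsFAlgebra U) (hunit : ι e = 1)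
    (f h : U) (hf : f ∈ RieszCond.LInfty ι F) (hh : h ∈ RieszCond.R ι F) (hpos : 0 ≤ h) :
    -- the infimum defining `M_F(f)` exists and belongs to `R(F)`
    (RieszCond.condSup ι F f ∈ RieszCond.R ι F ∧
      IsGLB {g | g ∈ RieszCond.R ι F ∧ f ≤ g} (RieszCond.condSup ι F f)) ∧
    -- `h f` belongs to `L^∞(F)`, and the infimum defining `M_F(h f)` exists
    (h * f ∈ RieszCond.LInfty ι F ∧
      RieszCond.condSup ι F (h * f) ∈ RieszCond.R ι F ∧
      IsGLB {g | g ∈ RieszCond.R ι F ∧ h * f ≤ g} (RieszCond.condSup ι F (h * f))) ∧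
    -- the averaging property
    RieszCond.condSup ι F (h * f) = h * RieszCond.condSup ι F f := by
  have hcs := hF.condSup_spec hι hU hunit hf
  have hmul := hF.mul_mem_LInfty hι hU hunit hf hh hpos
  exact ⟨hcs, ⟨hmul, hF.condSup_spec hι hU hunit hmul⟩,
    RieszCond.condSup_eq (hF.isGLB_mul hι hU hunit hh hpos hcs.1 hcs.2)⟩
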